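/- Let $\tau$ be a relational vocabulary (with equality). Formulas over $\tau$ are built from literals $R(\vec x)$, $\neg R(\vec x)$ (for $R\in\tau$), $x=y$, $\neg\, x=y$ and dependency atoms by $\wedge,\vee,\exists x,\forall x$. In probabilistic independence logic $\mathrm{FO}(\perp\!\!\!\perp_{\mathrm c})$ the dependency atoms are the conditional independence atoms $\vec y\perp\!\!\!\perp_{\vec x}\vec z$; in entropy logic $\mathrm{FO}(\mathrm H)$ they are the entropy atoms $\mathrm H(\vec x)=\mathrm H(\vec y)$, where the tuples may have different lengths (and tuples of variables may be empty). Let $\mathcal A$ be a finite $\tau$-structure with nonempty universe $A$ and $D$ a finite set of variables. A probability distribution $\mathbb X\colon A^D\to[0,1]$ on the assignments $s\colon D\to A$ is called a probabilistic team over $D$; the empty team is the weight function that is constantly $0$. Write $|\mathbb X_{\vec x=\vec a}|=\sum_{s(\vec x)=\vec a}\mathbb X(s)$ and $\mathrm H_{\mathbb X}(\vec x)=-\sum_{\vec a\in A^{|\vec x|}}|\mathbb X_{\vec x=\vec a}|\log|\mathbb X_{\vec x=\vec a}|$ (with $0\log 0=0$). For $F$ assigning to each $t\colon D\to A$ a probability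 distribution $F(t)$ on $A$, let $\mathbb X(F/x)$ be the team over $D\cup\{x\}$ with $\mathbb X(F/x)(s')=\sum_{t(s'(x)/x)=s'}\mathbb X(t)\,F(t)(s'(x))$, and let $\mathbb X(A/x)$ be the case where every $F(t)$ is uniform. Satisfaction is defined as follows. * $\mathcal A\models_{\mathbb X}\lambda$, for a literal $\lambda$, iff $\mathcal A\models_s\lambda$ for all $s$ with $\mathbb X(s)\neq 0$. * $\mathcal A\models_{\mathbb X}\vec y\perp\!\!\!\perp_{\vec x}\vec z$ iff $|\mathbb X_{\vec x\vec y=s(\vec x\vec y)}|\cdot|\mathbb X_{\vec x\vec z=s(\vec x\vec z)}|=|\mathbb X_{\vec x\vec y\vec z=s(\vec x\vec y\vec z)}|\cdot|\mathbb X_{\vec x=s(\vec x)}|$ for all assignments $s$ of the variables in $\vec x\vec y\vec z$. * $\mathcal A\models_{\mathbb X}\mathrm H(\vec x)=\mathrm H(\vec y)$ iff $\mathrm H_{\mathbb X}(\vec x)=\mathrm H_{\mathbb X}(\vec y)$. * $\mathcal A\models_{\mathbb X}\phi\wedge\psi$ iff $\mathcal A\models_{\mathbb X}\phi$ and $\mathcal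 A\models_{\mathbb X}\psi$. * $\mathcal A\models_{\mathbb X}\phi\vee\psi$ iff there are $k\in[0,1]$ and $\mathbb Y,\mathbb Z$, each a probabilistic team over $D$ or the empty team, with $\mathbb X=k\,\mathbb Y+(1-k)\,\mathbb Z$, $\mathcal A\models_{\mathbb Y}\phi$ and $\mathcal A\models_{\mathbb Z}\psi$. * $\mathcal A\models_{\mathbb X}\exists x\phi$ iff $\mathcal A\models_{\mathbb X(F/x)}\phi$ for some $F$. * $\mathcal A\models_{\mathbb X}\forall x\phi$ iff $\mathcal A\models_{\mathbb X(A/x)}\phi$. **Corollary.** $\mathrm{FO}(\perp\!\!\!\perp_{\mathrm c})\le\mathrm{FO}(\mathrm H)$: for every formula $\phi$ of $\mathrm{FO}(\perp\!\!\!\perp_{\mathrm c})$ over $\tau$ there is a formula $\psi$ of $\mathrm{FO}(\mathrm H)$ over $\tau$, with no free variables other than those of $\phi$, such that for every finite $\tau$-structure $\mathcal A$, every finite set $D$ of variables containing the free variables of $\phi$, and every probabilistic team $\mathbb X$ of $\mathcal A$ over $D$, $$\mathcal A\models_{\mathbb X}\phi\iff\mathcal A\models_{\mathbb X}\psi .$$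 -/

import Mathlib

open scoped BigOperators

universe u v w

namespace ProbTeam

/-- First-order variables are natural numbers. An assignment of `A` for the finite set of
variables `D` is a function `D → A`. -/
abbrev Assignment (D : Finset ℕ) (A : Type w) : Type w := {x : ℕ // x ∈ D} → A

/-- A weight function on the (maximal) team of all assignments of `A` for `D`. The weights are
required to be non-negative wherever such functions are quantified over. -/
abbrev Team (D : Finset ℕ) (A : Type w) : Type w := Assignment D A → ℝ

section Assignments

variable {A : Type w} {D : Finset ℕ}

/-- `s.HasValue x a`: the variable `x` is in the domain of `s`, and `s(x) = a`. -/
def Assignment.HasValue (s : Assignment D A) (x : ℕ) (a : A) : Prop :=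
  ∃ h : x ∈ D, s ⟨x, h⟩ = a

/-- `s(x₁ … xₖ) = (a₁, …, aₖ)`. -/
def Assignment.HasValues (s : Assignment D A) {k : ℕ} (x : Fin k → ℕ) (a : Fin k → A) : Prop :=
  ∀ i, s.HasValue (x i) (a i)

/-- The modified assignment `s(a/x) : D ∪ {x} → A`. -/
def Assignment.update (s : Assignment D A) (x : ℕ) (a : A) : Assignment (insert x D) A :=
  fun y => if h : y.1 = x then a else s ⟨y.1, Finset.mem_of_mem_insert_of_ne y.2 h⟩

end Assignments

section Teams

variable {A : Type w} [Fintype A] {D : Finset ℕ}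

/-- `X` is a probability distribution on the assignments of `A` for `D`. -/
def Team.IsDistribution (X : Team D A) : Prop :=
  (∀ s, 0 ≤ X s) ∧ ∑ s, X s = 1

/-- `X` is a probability distribution, or the empty team (all weights are zero). -/
def Team.IsDistributionOrEmpty (X : Team D A) : Prop :=
  X.IsDistribution ∨ ∀ s, X s = 0

open Classical in
/-- The weight `|X_{x = a}|`, for a tuple of variables `x` and a tuple of values `a`. -/
noncomputable def Team.weight (X : Team D A) {k : ℕ} (x : Fin k → ℕ) (a : Fin k → A) : ℝ :=
  ∑ s, if s.HasValues x a then X s else 0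

/-- The Shannon entropy (with the natural logarithm) of the tuple of variables `x` in `X`. -/
noncomputable def Team.entropy (X : Team D A) (x : List ℕ) : ℝ :=
  -∑ a : Fin x.length → A, X.weight x.get a * Real.log (X.weight x.get a)

open Classical in
/-- The team `X(F/x)`; for `X(F/x)(s')`, sum `X(t) · F(t)(s'(x))` over all `t` with
`t(s'(x)/x) = s'`. -/
noncomputable def Team.extend (X : Team D A) (x : ℕ) (F : Assignment D A → A → ℝ) :
    Team (insert x D) A :=
  fun s' => ∑ t : Assignment D A,
    if t.update x (s' ⟨x, Finset.mem_insert_self x D⟩) = s' then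
      X t * F t (s' ⟨x, Finset.mem_insert_self x D⟩) else 0

/-- The team `X(A/x)`: the values of `x` are distributed uniformly over `A`. -/
noncomputable def Team.extendUniform (X : Team D A) (x : ℕ) : Team (insert x D) A :=
  X.extend x (fun _ _ => 1 / (Fintype.card A : ℝ))

/-- The `k`-scaled union of two teams. -/
def Team.scaledUnion (k : ℝ) (Y Z : Team D A) : Team D A :=
  fun s => k * Y s + (1 - k) * Z s

end Teams

/-- The two kinds of dependency atoms: `indep x y z` states that `y` and `z` are independent given
`x`, and `entropy x y` states that the entropies of `x` and `y` are equal. The tuples may be empty,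
may have repetitions and may overlap. -/
inductive DepAtom : Type
  | indep (x y z : List ℕ) : DepAtom
  | entropy (x y : List ℕ) : DepAtom

/-- The variables of an atom. -/
def DepAtom.vars : DepAtom → Finset ℕ
  | .indep x y z => (x ++ y ++ z).toFinset
  | .entropy x y => (x ++ y).toFinset

def DepAtom.IsIndep : DepAtom → Prop
  | .indep _ _ _ => True
  | .entropy _ _ => False

def DepAtom.IsEntropy : DepAtom → Prop
  | .indep _ _ _ => False
  | .entropy _ _ => True

/-- `|X_{x = s(x)}|`, where `s` gives values to (at least) the variables in `x`. -/
noncomputable def Team.weightAt {A : Type w} [Fintype A] {D : Finset ℕ} (X : Team D A)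
    (s : ℕ → A) (x : List ℕ) : ℝ :=
  X.weight x.get (fun i => s (x.get i))

/-- The semantics of the atoms. In the independence atom only the values of `s` on the variables of
`x`, `y`, `z` matter. -/
def DepAtom.Holds {A : Type w} [Fintype A] {D : Finset ℕ} (X : Team D A) : DepAtom → Prop
  | .indep x y z => ∀ s : ℕ → A,
      X.weightAt s (x ++ y) * X.weightAt s (x ++ z) =
        X.weightAt s (x ++ y ++ z) * X.weightAt s x
  | .entropy x y => X.entropy x = X.entropy y

/-- Formulas, in negation normal form, of first-order logic over the relational vocabulary `L` (with
equality), extended by dependency atoms. -/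
inductive Formula (L : FirstOrder.Language.{u, v}) : Type v
  | rel {n : ℕ} (R : L.Relations n) (x : Fin n → ℕ) : Formula L
  | nrel {n : ℕ} (R : L.Relations n) (x : Fin n → ℕ) : Formula L
  | eq (x y : ℕ) : Formula L
  | neq (x y : ℕ) : Formula L
  | atom (α : DepAtom) : Formula L
  | and (φ ψ : Formula L) : Formula L
  | or (φ ψ : Formula L) : Formula L
  | ex (x : ℕ) (φ : Formula L) : Formula L
  | all (x : ℕ) (φ : Formula L) : Formula L

namespace Formula

variable {L : FirstOrder.Language.{u, v}}

/-- The free variables of a formula. -/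
def free : Formula L → Finset ℕ
  | rel _ x => Finset.univ.image x
  | nrel _ x => Finset.univ.image x
  | eq x y => {x, y}
  | neq x y => {x, y}
  | atom α => α.vars
  | and φ ψ => φ.free ∪ ψ.free
  | or φ ψ => φ.free ∪ ψ.free
  | ex x φ => φ.free.erase x
  | all x φ => φ.free.erase x

/-- Every dependency atom that occurs in the formula satisfies `P`. -/
def AtomsIn (P : DepAtom → Prop) : Formula L → Prop
  | rel _ _ => True
  | nrel _ _ => True
  | eq _ _ => True
  | neq _ _ => True
  | atom α => P α
  | and φ ψ => φ.AtomsIn P ∧ ψ.AtomsIn P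
  | or φ ψ => φ.AtomsIn P ∧ ψ.AtomsIn P
  | ex _ φ => φ.AtomsIn P
  | all _ φ => φ.AtomsIn P

/-- Probabilistic team semantics. It is meant for teams whose domain `D` contains the free variables
of the formula. In the clause for disjunction either part may be the empty team, so that a team that
satisfies one of the disjuncts satisfies the disjunction. -/
def Sat {A : Type w} [Fintype A] [L.Structure A] :
    Formula L → {D : Finset ℕ} → Team D A → Prop
  | rel R x, _, X => ∀ s, X s ≠ 0 →
      ∃ a, s.HasValues x a ∧ FirstOrder.Language.Structure.RelMap R a
  | nrel R x, _, X => ∀ s, X s ≠ 0 →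
      ∃ a, s.HasValues x a ∧ ¬ FirstOrder.Language.Structure.RelMap R a
  | eq x y, _, X => ∀ s, X s ≠ 0 → ∃ a b, s.HasValue x a ∧ s.HasValue y b ∧ a = b
  | neq x y, _, X => ∀ s, X s ≠ 0 → ∃ a b, s.HasValue x a ∧ s.HasValue y b ∧ a ≠ b
  | atom α, _, X => α.Holds X
  | and φ ψ, _, X => φ.Sat X ∧ ψ.Sat X
  | or φ ψ, D, X => ∃ (k : ℝ) (Y Z : Team D A), 0 ≤ k ∧ k ≤ 1 ∧
      Y.IsDistributionOrEmpty ∧ Z.IsDistributionOrEmpty ∧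
      Team.scaledUnion k Y Z = X ∧ φ.Sat Y ∧ ψ.Sat Z
  | ex x φ, D, X => ∃ F : Assignment D A → A → ℝ,
      (∀ t, (∀ a, 0 ≤ F t a) ∧ ∑ a, F t a = 1) ∧ φ.Sat (X.extend x F)
  | all x φ, _, X => φ.Sat (X.extendUniform x)

/-- `φ` and `ψ` are equivalent: they are satisfied by the same probability distributions, over all
(non-empty) finite structures and all finite domains that contain their free variables. -/
def Equivalent (φ ψ : Formula L) : Prop :=
  ∀ (A : Type w) [Fintype A] [Nonempty A] [L.Structure A] (D : Finset ℕ),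
    φ.free ⊆ D → ψ.free ⊆ D →
      ∀ X : Team D A, X.IsDistribution → (φ.Sat X ↔ ψ.Sat X)

end Formula

/-- Probabilistic independence logic. -/
def FOIndep (L : FirstOrder.Language.{u, v}) : Set (Formula L) :=
  {φ | φ.AtomsIn DepAtom.IsIndep}

/-- Entropy logic. -/
def FOEntropy (L : FirstOrder.Language.{u, v}) : Set (Formula L) :=
  {φ | φ.AtomsIn DepAtom.IsEntropy}

/-- The logic `S` is expressively subsumed by the logic `T`: every formula of `S` is equivalent to a
formula of `T` that has no further free variables. -/
def Subsumed {L : FirstOrder.Language.{u, v}} (S T : Set (Formula L)) : Prop :=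
  ∀ φ ∈ S, ∃ ψ ∈ T, ψ.free ⊆ φ.free ∧ Formula.Equivalent.{u, v, w} φ ψ

end ProbTeam

/-! Conditional independence of y and z given x is the vanishing of conditional mutual information:
H(xy) + H(xz) = H(xyz) + H(x). An entropy atom compares only two single entropies, so these sums
must be realised by single tuples. Quantify a, b, c uniformly and independently over A, with n =
|A|. Let u, v copy y, z when a = b, let v' copy z when a = c, and let each equal a otherwise; since
a is already in the tuple, an erased copy carries no information. By the chain rule, H(abcxuv) and
H(abcxuv') are both H(abc) plus the average, over the triples, of the entropy of x with the
surviving ones of y, z. The cases a = b ≠ c and a = c ≠ b contain n² - n triples each, so n³ times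
the difference of the two entropies is (n² - n)(H(xyz) + H(x) - H(xy) - H(xz)). For n > 1 it
vanishes exactly under independence; for n = 1 independence is trivial.

The copies are definable: their guard is a disjunction of conjunctions of first-order literals,
hence flat (`Formula.sat_or_iff_of_flat`), and it forces the quantified value on the support
(`Formula.sat_letCase`). The atom is then handled by `Formula.sat_ofIndep_iff`, from
`holds_indep_iff`, `relEntropy_prod_three` and `sum_cases_sub`. The translation commutes with
everything else. -/

namespace ProbTeam

/-! ### Entropy of partitions of a weighted finite set -/

section RelEntropy

open Classical in
/-- The probability of the `r`-class of `ω`. -/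
noncomputable def classWeight {Ω : Type*} [Fintype Ω] (p : Ω → ℝ) (r : Ω → Ω → Prop) (ω : Ω) : ℝ :=
  ∑ ω', if r ω' ω then p ω' else 0

theorem classWeight_eq {Ω : Type*} [Fintype Ω] (p : Ω → ℝ) (r : Ω → Ω → Prop) (ω : Ω)
    [∀ ω', Decidable (r ω' ω)] : classWeight p r ω = ∑ ω', if r ω' ω then p ω' else 0 := by
  unfold classWeight
  congr!

/-- The Shannon entropy of the partition of `Ω` into the classes of `r`. -/
noncomputable def relEntropy {Ω : Type*} [Fintype Ω] (p : Ω → ℝ) (r : Ω → Ω → Prop) : ℝ :=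
  -∑ ω, p ω * Real.log (classWeight p r ω)

variable {Ω : Type*} [Fintype Ω] {p : Ω → ℝ}

theorem classWeight_pos (hp : ∀ ω, 0 ≤ p ω) {r : Ω → Ω → Prop} (hr : ∀ ω, r ω ω) {ω : Ω}
    (h : p ω ≠ 0) : 0 < classWeight p r ω := by
  classical
  have h1 : (if r ω ω then p ω else 0) ≤ classWeight p r ω :=
    Finset.single_le_sum (f := fun ω' => if r ω' ω then p ω' else 0)
      (fun ω' _ => by split_ifs <;> simp [hp]) (Finset.mem_univ ω)
  rw [if_pos (hr ω)] at h1
  exact lt_of_lt_of_le (lt_of_le_of_ne (hp ω) (Ne.symm h)) h1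

theorem classWeight_prod {α : Type*} [Fintype α] (c : ℝ) {r : Ω × α → Ω × α → Prop}
    {q : α → Ω → Ω → Prop}
    (h : ∀ ω a ω' a', r (ω, a) (ω', a') ↔ a = a' ∧ q a ω ω') (ω : Ω) (a : α) :
    classWeight (fun z : Ω × α => p z.1 * c) r (ω, a) = classWeight p (q a) ω * c := by
  classical
  simp only [classWeight, Fintype.sum_prod_type, h, Finset.sum_mul]
  refine Finset.sum_congr rfl fun ω' _ => ?_
  rw [Finset.sum_eq_single a]
  · by_cases hq : q a ω' ω <;> simp [hq]
  · intro b _ hb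
    simp [hb]
  · simp

/-- The entropy of a partition that refines a uniform and independent coordinate. -/
theorem exists_relEntropy_prod_eq {α : Type*} [Fintype α] (hp : ∀ ω, 0 ≤ p ω) {c : ℝ}
    (hc : c ≠ 0) :
    ∃ C : ℝ, ∀ (r : Ω × α → Ω × α → Prop) (q : α → Ω → Ω → Prop), (∀ a ω, q a ω ω) →
      (∀ ω a ω' a', r (ω, a) (ω', a') ↔ a = a' ∧ q a ω ω') →
      relEntropy (fun z : Ω × α => p z.1 * c) r = c * (∑ a, relEntropy p (q a)) + C := by
  -- The constant comes from log c alone and does not depend on the partition, so it cancels when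
  -- two entropies are compared.
  refine ⟨-(Fintype.card α * (c * Real.log c) * ∑ ω, p ω), fun r q hq h => ?_⟩
  have key : ∀ ω a, p ω * c * Real.log (classWeight (fun z : Ω × α => p z.1 * c) r (ω, a)) =
      c * (p ω * Real.log (classWeight p (q a) ω)) + p ω * (c * Real.log c) := by
    intro ω a
    rw [classWeight_prod c h]
    by_cases h0 : p ω = 0
    · simp [h0]
    · rw [Real.log_mul (classWeight_pos hp (hq a) h0).ne' hc]
      ring
  simp only [relEntropy, Fintype.sum_prod_type, key]
  rw [Finset.sum_comm]
  simp only [Finset.sum_add_distrib, ← Finset.mul_sum, ← Finset.sum_mul, Finset.sum_neg_distrib,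
    Finset.sum_const, Finset.card_univ, nsmul_eq_mul]
  ring

end RelEntropy

/-! ### Conditional mutual information and independence -/

section MutualInformation

/-- The vanishing of the conditional mutual information of a weight function on triples forces
conditional independence. -/
theorem factorizes_of_sum_log_eq_zero {α β γ : Type*} [Fintype α] [Fintype β] [Fintype γ]
    {m : α → β → γ → ℝ} (hm : ∀ a b c, 0 ≤ m a b c)
    (h : ∑ a, ∑ b, ∑ c, m a b c * (Real.log (m a b c) + Real.log (∑ b, ∑ c, m a b c) -
      Real.log (∑ c, m a b c) - Real.log (∑ b, m a b c)) = 0) (a : α) (b : β) (c : γ) :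
    (∑ c, m a b c) * (∑ b, m a b c) = m a b c * ∑ b, ∑ c, m a b c := by
  set f : α → β → ℝ := fun a b => ∑ c, m a b c with hf
  set g : α → γ → ℝ := fun a c => ∑ b, m a b c with hg
  set e : α → ℝ := fun a => ∑ b, f a b with he
  have he' : ∀ a, ∑ c, g a c = e a := fun a => Finset.sum_comm
  have hf0 : ∀ a b, 0 ≤ f a b := fun a b => Finset.sum_nonneg fun c _ => hm a b c
  have hg0 : ∀ a c, 0 ≤ g a c := fun a c => Finset.sum_nonneg fun b _ => hm a b c
  have he0 : ∀ a, 0 ≤ e a := fun a => Finset.sum_nonneg fun b _ => hf0 a b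
  have hmf : ∀ a b c, m a b c ≤ f a b := fun a b c =>
    Finset.single_le_sum (fun c _ => hm a b c) (Finset.mem_univ c)
  have hmg : ∀ a b c, m a b c ≤ g a c := fun a b c =>
    Finset.single_le_sum (f := fun b => m a b c) (fun b _ => hm a b c) (Finset.mem_univ b)
  have hfe : ∀ a b, f a b ≤ e a := fun a b =>
    Finset.single_le_sum (fun b _ => hf0 a b) (Finset.mem_univ b)
  -- The conditionally independent weight with the same marginals as `m`. The mutual information is
  -- the divergence of `m` from `t`; as the total masses agree, it is a sum of nonnegative terms t ·
  -- klFun(m/t), each zero only where t = 0 or m = t.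
  set t : α → β → γ → ℝ := fun a b c => f a b * g a c / e a with ht
  have ht0 : ∀ a b c, 0 ≤ t a b c := fun a b c =>
    div_nonneg (mul_nonneg (hf0 a b) (hg0 a c)) (he0 a)
  have hsum : ∑ a, ∑ b, ∑ c, t a b c = ∑ a, ∑ b, ∑ c, m a b c := by
    refine Finset.sum_congr rfl fun a _ => ?_
    simp only [ht, ← Finset.sum_div, ← Finset.mul_sum, ← Finset.sum_mul, he']
    exact mul_self_div_self (e a)
  have key : ∀ a b c, t a b c * InformationTheory.klFun (m a b c / t a b c) =
      m a b c * (Real.log (m a b c) + Real.log (e a) - Real.log (f a b) - Real.log (g a c))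
        + (t a b c - m a b c) := by
    intro a b c
    rcases (hm a b c).eq_or_lt with h0 | h0
    · simp [← h0, InformationTheory.klFun]
    · have h1 := h0.trans_le (hmf a b c)
      have h2 := h0.trans_le (hmg a b c)
      have h3 := h1.trans_le (hfe a b)
      have h4 : 0 < t a b c := by positivity
      rw [InformationTheory.klFun, Real.log_div h0.ne' h4.ne', ht,
        Real.log_div (mul_pos h1 h2).ne' h3.ne', Real.log_mul h1.ne' h2.ne']
      field_simp
      ring
  have hzero : ∑ a, ∑ b, ∑ c, t a b c * InformationTheory.klFun (m a b c / t a b c) = 0 := by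
    simp only [key, Finset.sum_add_distrib, Finset.sum_sub_distrib, hsum]
    linarith
  have hterm : ∀ a b c, 0 ≤ t a b c * InformationTheory.klFun (m a b c / t a b c) := fun a b c =>
    mul_nonneg (ht0 a b c) (InformationTheory.klFun_nonneg (div_nonneg (hm a b c) (ht0 a b c)))
  have h1 := (Finset.sum_eq_zero_iff_of_nonneg fun a _ => Finset.sum_nonneg fun b _ =>
    Finset.sum_nonneg fun c _ => hterm a b c).1 hzero a (Finset.mem_univ a)
  have h2 := (Finset.sum_eq_zero_iff_of_nonneg fun b _ =>
    Finset.sum_nonneg fun c _ => hterm a b c).1 h1 b (Finset.mem_univ b)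
  have h3 := (Finset.sum_eq_zero_iff_of_nonneg fun c _ => hterm a b c).1 h2 c (Finset.mem_univ c)
  change f a b * g a c = m a b c * e a
  rcases (he0 a).eq_or_lt with h0 | h0
  · have : f a b = 0 := le_antisymm ((hfe a b).trans h0.ge) (hf0 a b)
    simp [this, ← h0]
  rcases mul_eq_zero.1 h3 with h4 | h4
  -- Where `t` vanishes, so does `m`, which is bounded by both marginals.
  · have h5 : f a b * g a c = 0 := by simpa [ht, h0.ne'] using h4
    have h6 : m a b c = 0 := by
      rcases mul_eq_zero.1 h5 with h6 | h6
      · exact le_antisymm (h6 ▸ hmf a b c) (hm a b c)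
      · exact le_antisymm (h6 ▸ hmg a b c) (hm a b c)
    rw [h5, h6, zero_mul]
  · rw [InformationTheory.klFun_eq_zero_iff (div_nonneg (hm a b c) (ht0 a b c))] at h4
    have h5 : t a b c ≠ 0 := fun h => by simp [h] at h4
    rw [div_eq_one_iff_eq h5] at h4
    rw [h4, ht]
    field_simp

variable {Ω : Type*} [Fintype Ω] {p : Ω → ℝ}

/-- Taking logarithms of the product identity gives equality termwise; points of weight zero
contribute nothing. -/
theorem relEntropy_add_eq {r₁ r₂ r₃ r₄ : Ω → Ω → Prop} (hp : ∀ ω, 0 ≤ p ω)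
    (h₁ : ∀ ω, r₁ ω ω) (h₂ : ∀ ω, r₂ ω ω) (h₃ : ∀ ω, r₃ ω ω) (h₄ : ∀ ω, r₄ ω ω)
    (h : ∀ ω, p ω ≠ 0 → classWeight p r₁ ω * classWeight p r₂ ω =
      classWeight p r₃ ω * classWeight p r₄ ω) :
    relEntropy p r₁ + relEntropy p r₂ = relEntropy p r₃ + relEntropy p r₄ := by
  simp only [relEntropy, ← neg_add, ← Finset.sum_add_distrib]
  congr 1
  refine Finset.sum_congr rfl fun ω _ => ?_
  by_cases h0 : p ω = 0
  · simp [h0]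
  · rw [← mul_add, ← mul_add,
      ← Real.log_mul (classWeight_pos hp h₁ h0).ne' (classWeight_pos hp h₂ h0).ne',
      ← Real.log_mul (classWeight_pos hp h₃ h0).ne' (classWeight_pos hp h₄ h0).ne', h ω h0]

-- The joint law `m` of `f`, `g`, `k` turns the entropy identity into vanishing mutual information
-- for `m`.
open Classical in
theorem factorizes_of_relEntropy_add_eq {α β γ : Type*} [Fintype α] [Fintype β] [Fintype γ]
    (hp : ∀ ω, 0 ≤ p ω) (f : Ω → α) (g : Ω → β) (k : Ω → γ)
    (h : relEntropy p (fun ω ω' => f ω = f ω' ∧ g ω = g ω') +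
        relEntropy p (fun ω ω' => f ω = f ω' ∧ k ω = k ω') =
      relEntropy p (fun ω ω' => f ω = f ω' ∧ g ω = g ω' ∧ k ω = k ω') +
        relEntropy p (fun ω ω' => f ω = f ω')) (a : α) (b : β) (c : γ) :
    (∑ ω, if f ω = a ∧ g ω = b then p ω else 0) * (∑ ω, if f ω = a ∧ k ω = c then p ω else 0) =
      (∑ ω, if f ω = a ∧ g ω = b ∧ k ω = c then p ω else 0) *
        ∑ ω, if f ω = a then p ω else 0 := by
  set m : α → β → γ → ℝ := fun a b c => ∑ ω, if f ω = a ∧ g ω = b ∧ k ω = c then p ω else 0 with hm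
  have e1 : ∀ a b, ∑ c, m a b c = ∑ ω, if f ω = a ∧ g ω = b then p ω else 0 := by
    intro a b
    rw [Finset.sum_comm]
    refine Finset.sum_congr rfl fun ω _ => ?_
    simp [← and_assoc, ite_and]
  have e2 : ∀ a c, ∑ b, m a b c = ∑ ω, if f ω = a ∧ k ω = c then p ω else 0 := by
    intro a b
    rw [Finset.sum_comm]
    refine Finset.sum_congr rfl fun ω _ => ?_
    simp [ite_and]
  have e3 : ∀ a, ∑ b, ∑ ω, (if f ω = a ∧ g ω = b then p ω else 0) =
      ∑ ω, if f ω = a then p ω else 0 := by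
    intro a
    rw [Finset.sum_comm]
    refine Finset.sum_congr rfl fun ω _ => ?_
    simp [ite_and]
  have hm0 : ∀ a b c, 0 ≤ m a b c := fun a b c =>
    Finset.sum_nonneg fun ω _ => by split_ifs <;> simp [hp]
  have fib : ∀ Φ : α → β → γ → ℝ, ∑ a, ∑ b, ∑ c, m a b c * Φ a b c =
      ∑ ω, p ω * Φ (f ω) (g ω) (k ω) := by
    intro Φ
    have : ∀ a b c, m a b c * Φ a b c = ∑ ω, if f ω = a then if g ω = b then if k ω = c then
        p ω * Φ a b c else 0 else 0 else 0 := by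
      intro a b c
      simp only [hm, Finset.sum_mul, ite_and, ite_mul, zero_mul]
    simp only [this]
    calc _ = ∑ a, ∑ b, ∑ ω, _ := Finset.sum_congr rfl fun a _ =>
          Finset.sum_congr rfl fun b _ => Finset.sum_comm
      _ = ∑ a, ∑ ω, ∑ b, _ := Finset.sum_congr rfl fun a _ => Finset.sum_comm
      _ = ∑ ω, ∑ a, ∑ b, _ := Finset.sum_comm
      _ = _ := Finset.sum_congr rfl fun ω _ => by simp
  rw [← e1, ← e2, ← e3]
  simp only [← e1]
  refine factorizes_of_sum_log_eq_zero hm0 ?_ a b c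
  rw [fib]
  simp only [e1, e2, e3]
  simp only [relEntropy, classWeight_eq] at h
  simp only [mul_sub, mul_add, Finset.sum_sub_distrib, Finset.sum_add_distrib, hm]
  linarith

end MutualInformation

/-! ### Assignments as restrictions of total valuations -/

section Assignments

variable {A : Type w} {D : Finset ℕ}

open Classical in
/-- An extension of an assignment to all variables. -/
noncomputable def Assignment.total [Nonempty A] (s : Assignment D A) : ℕ → A :=
  fun x => if h : x ∈ D then s ⟨x, h⟩ else Classical.arbitrary A

/-- The restriction of a valuation of all variables to `D`. -/
def Assignment.restrict (D : Finset ℕ) (f : ℕ → A) : Assignment D A := fun x => f x.1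

theorem Assignment.restrict_total [Nonempty A] (s : Assignment D A) :
    Assignment.restrict D s.total = s := by
  funext x
  simp [Assignment.restrict, Assignment.total]

theorem Assignment.total_restrict [Nonempty A] {f : ℕ → A} {x : ℕ} (hx : x ∈ D) :
    (Assignment.restrict D f).total x = f x := by
  simp [Assignment.restrict, Assignment.total, hx]

theorem Assignment.hasValue_iff [Nonempty A] {s : Assignment D A} {x : ℕ} {a : A} (hx : x ∈ D) :
    s.HasValue x a ↔ s.total x = a := by
  simp [Assignment.HasValue, Assignment.total, hx]

theorem Assignment.hasValue_restrict {f : ℕ → A} {x : ℕ} {a : A} (hx : x ∈ D) :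
    (Assignment.restrict D f).HasValue x a ↔ f x = a := by
  simp [Assignment.HasValue, Assignment.restrict, hx]

theorem Assignment.total_update [Nonempty A] (s : Assignment D A) {x y : ℕ} (a : A) (hy : y ∈ D) :
    (s.update x a).total y = Function.update s.total x a y := by
  by_cases h : y = x
  · subst h; simp [Assignment.update, Assignment.total]
  · simp [Assignment.update, Assignment.total, h, hy]

theorem Assignment.total_update_self [Nonempty A] (s : Assignment D A) (x : ℕ) (a : A) :
    (s.update x a).total x = a := by
  simp [Assignment.update, Assignment.total]

theorem Assignment.update_restrict (f : ℕ → A) (x : ℕ) (a : A) :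
    (Assignment.restrict D f).update x a =
      Assignment.restrict (insert x D) (Function.update f x a) := by
  funext y
  by_cases h : y.1 = x <;> simp [Assignment.update, Assignment.restrict, Function.update, h]

end Assignments

/-! ### Teams as laws of random valuations -/

section Laws

variable {A : Type w} [Fintype A] {D : Finset ℕ} {Ω : Type*} [Fintype Ω]

open Classical in
/-- `X` is the law, on the variables in `D`, of the random valuation `V` on the weighted finite
set `Ω`. -/
def Team.IsLaw (X : Team D A) (p : Ω → ℝ) (V : Ω → ℕ → A) : Prop :=
  ∀ s, X s = ∑ ω, if Assignment.restrict D (V ω) = s then p ω else 0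

theorem Team.isLaw_total [Nonempty A] (X : Team D A) :
    X.IsLaw X (fun s : Assignment D A => s.total) := by
  classical
  intro s
  simp [Assignment.restrict_total]

variable {X : Team D A} {p : Ω → ℝ} {V : Ω → ℕ → A}

/-- Change of variables, through which weights, entropies and team extensions are computed on the
sample space. -/
theorem Team.IsLaw.sum_mul (h : X.IsLaw p V) (Φ : Assignment D A → ℝ) :
    ∑ s, X s * Φ s = ∑ ω, p ω * Φ (Assignment.restrict D (V ω)) := by
  classical
  simp only [h _, Finset.sum_mul]
  rw [Finset.sum_comm]
  refine Finset.sum_congr rfl fun ω _ => ?_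
  simp [ite_mul]

open Classical in
theorem Team.IsLaw.weight_eq (h : X.IsLaw p V) {k : ℕ} {x : Fin k → ℕ} (hx : ∀ i, x i ∈ D)
    (a : Fin k → A) :
    X.weight x a = ∑ ω, if ∀ i, V ω (x i) = a i then p ω else 0 := by
  have := h.sum_mul (fun s => if s.HasValues x a then 1 else 0)
  simp only [mul_ite, mul_one, mul_zero] at this
  rw [Team.weight, this]
  refine Finset.sum_congr rfl fun ω _ => if_congr ?_ rfl rfl
  exact forall_congr' fun i => Assignment.hasValue_restrict (hx i)

open Classical in
theorem Team.IsLaw.weightAt_eq (h : X.IsLaw p V) {x : List ℕ} (hx : ∀ w ∈ x, w ∈ D)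
    (s : ℕ → A) : X.weightAt s x = ∑ ω, if ∀ w ∈ x, V ω w = s w then p ω else 0 := by
  rw [Team.weightAt, h.weight_eq fun i => hx _ (List.get_mem x i)]
  simp only [List.forall_mem_iff_get]

theorem Team.IsLaw.entropy_eq (h : X.IsLaw p V) {x : List ℕ} (hx : ∀ w ∈ x, w ∈ D) :
    X.entropy x = relEntropy p (fun ω ω' => ∀ w ∈ x, V ω w = V ω' w) := by
  classical
  simp only [Team.entropy, relEntropy, classWeight]
  congr 1
  simp only [h.weight_eq fun i => hx _ (List.get_mem x i), Finset.sum_mul]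
  rw [Finset.sum_comm]
  refine Finset.sum_congr rfl fun ω _ => ?_
  rw [Finset.sum_eq_single fun i => V ω (x.get i)]
  · simp [List.forall_mem_iff_get]
  · intro a _ ha
    rw [if_neg fun h => ha (funext fun i => (h i).symm), zero_mul]
  · simp

open Classical in
theorem Team.extend_apply (X : Team D A) (x : ℕ) (F : Assignment D A → A → ℝ)
    (s : Assignment (insert x D) A) :
    X.extend x F s = ∑ t, ∑ a, if t.update x a = s then X t * F t a else 0 := by
  refine Finset.sum_congr rfl fun t _ => ?_
  rw [Finset.sum_eq_single (s ⟨x, Finset.mem_insert_self x D⟩)]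
  · intro a _ ha
    rw [if_neg]
    rintro rfl
    simp [Assignment.update] at ha
  · simp

theorem Team.IsDistribution.extend {x : ℕ} {F : Assignment D A → A → ℝ} (hX : X.IsDistribution)
    (hF : ∀ t, (∀ a, 0 ≤ F t a) ∧ ∑ a, F t a = 1) : (X.extend x F).IsDistribution := by
  classical
  refine ⟨fun s => ?_, ?_⟩
  · rw [Team.extend_apply]
    refine Finset.sum_nonneg fun t _ => Finset.sum_nonneg fun a _ => ?_
    split_ifs
    · exact mul_nonneg (hX.1 t) ((hF t).1 a)
    · exact le_rfl
  · simp only [Team.extend_apply]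
    rw [Finset.sum_comm, ← hX.2]
    refine Finset.sum_congr rfl fun t _ => ?_
    rw [Finset.sum_comm]
    simp [← Finset.mul_sum, (hF t).2]

theorem uniform_isDistribution [Nonempty A] :
    (∀ _ : A, 0 ≤ 1 / (Fintype.card A : ℝ)) ∧ ∑ _ : A, 1 / (Fintype.card A : ℝ) = 1 := by
  refine ⟨fun _ => by positivity, ?_⟩
  simp

theorem Team.IsDistribution.extendUniform [Nonempty A] (hX : X.IsDistribution) (x : ℕ) :
    (X.extendUniform x).IsDistribution :=
  hX.extend fun _ => uniform_isDistribution

/-- Universal quantification adds an independent uniform coordinate to the sample space. -/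
theorem Team.IsLaw.extendUniform (h : X.IsLaw p V) (x : ℕ) :
    (X.extendUniform x).IsLaw (fun z : Ω × A => p z.1 * (1 / (Fintype.card A : ℝ)))
      (fun z => Function.update (V z.1) x z.2) := by
  classical
  intro s
  have := h.sum_mul fun t => ∑ a : A, if t.update x a = s then 1 / (Fintype.card A : ℝ) else 0
  simp only [Finset.mul_sum, mul_ite, mul_zero, Assignment.update_restrict] at this
  rw [Team.extendUniform, Team.extend_apply, this, Fintype.sum_prod_type]

open Classical in
/-- The point mass at `g t`. -/
noncomputable def pointMass (g : Assignment D A → A) (t : Assignment D A) (a : A) : ℝ :=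
  if a = g t then 1 else 0

theorem pointMass_isDistribution (g : Assignment D A → A) (t : Assignment D A) :
    (∀ a, 0 ≤ pointMass g t a) ∧ ∑ a, pointMass g t a = 1 := by
  classical
  refine ⟨fun a => ?_, by simp [pointMass]⟩
  unfold pointMass
  split_ifs <;> norm_num

/-- A functionally determined variable needs no new randomness, so the sample space stays the same.
-/
theorem Team.IsLaw.extend_pointMass (h : X.IsLaw p V) (x : ℕ) {g : Assignment D A → A}
    {g' : (ℕ → A) → A} (hg : ∀ f, g (Assignment.restrict D f) = g' f) :
    (X.extend x (pointMass g)).IsLaw p (fun ω => Function.update (V ω) x (g' (V ω))) := by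
  classical
  intro s
  have := h.sum_mul fun t => if t.update x (g t) = s then 1 else 0
  simp only [mul_ite, mul_zero, mul_one, Assignment.update_restrict, hg] at this
  rw [Team.extend_apply, ← this]
  refine Finset.sum_congr rfl fun t _ => ?_
  rw [Finset.sum_eq_single (g t)]
  · simp [pointMass]
  · intro a _ ha
    simp [pointMass, ha]
  · simp

/-- If the values of `x` in the support of `X(F/x)` are given by `g`, then `X(F/x)` is the extension
of `X` by `g`. -/
theorem Team.extend_eq_extend_pointMass {x : ℕ} {F : Assignment D A → A → ℝ}
    {g : Assignment D A → A} (hX : ∀ s, 0 ≤ X s) (hF : ∀ t, (∀ a, 0 ≤ F t a) ∧ ∑ a, F t a = 1)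
    (h : ∀ t a, X.extend x F (t.update x a) ≠ 0 → a = g t) :
    X.extend x F = X.extend x (pointMass g) := by
  classical
  funext s
  have hpos : ∀ s t a, 0 ≤ if t.update x a = s then X t * F t a else 0 := by
    intro s t a
    split_ifs
    · exact mul_nonneg (hX t) ((hF t).1 a)
    · exact le_rfl
  have h0 : ∀ t a, a ≠ g t → X t * F t a = 0 := by
    intro t a ha
    have h1 : X.extend x F (t.update x a) = 0 := not_not.1 (mt (h t a) ha)
    rw [Team.extend_apply, Finset.sum_eq_zero_iff_of_nonneg
      fun t _ => Finset.sum_nonneg fun a _ => hpos _ t a] at h1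
    have h2 := (Finset.sum_eq_zero_iff_of_nonneg fun a _ => hpos _ t a).1 (h1 t (Finset.mem_univ t))
      a (Finset.mem_univ a)
    simpa using h2
  -- `F` and the point mass may differ where `X` is zero, so only their products with `X t` are
  -- compared.
  have key : ∀ t a, X t * F t a = X t * pointMass g t a := by
    intro t a
    by_cases ha : a = g t
    · subst ha
      have : ∑ a, X t * F t a = X t := by rw [← Finset.mul_sum, (hF t).2, mul_one]
      rw [Finset.sum_eq_single (g t) (fun a _ ha => h0 t a ha) (by simp)] at this
      simp [this, pointMass]
    · simp [h0 t a ha, pointMass, ha]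
  simp only [Team.extend_apply, key]

end Laws

/-! ### Flat disjunctions and the empty team -/

section Flatness

variable {A : Type w} [Fintype A] {D : Finset ℕ} {L : FirstOrder.Language.{u, v}} [L.Structure A]

/-- The disjunction of flat formulas is flat. -/
theorem Formula.sat_or_iff_of_flat {φ ψ : Formula L} {P Q : Assignment D A → Prop}
    (hφ : ∀ Y : Team D A, φ.Sat Y ↔ ∀ s, Y s ≠ 0 → P s)
    (hψ : ∀ Y : Team D A, ψ.Sat Y ↔ ∀ s, Y s ≠ 0 → Q s) {X : Team D A} (hX : X.IsDistribution) :
    (φ.or ψ).Sat X ↔ ∀ s, X s ≠ 0 → P s ∨ Q s := by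
  classical
  constructor
  · rintro ⟨k, Y, Z, -, -, -, -, rfl, hY, hZ⟩ s hs
    by_cases h : Y s = 0
    · refine Or.inr ((hψ Z).1 hZ s fun h' => hs ?_)
      simp [Team.scaledUnion, h, h']
    · exact Or.inl ((hφ Y).1 hY s h)
  · intro h
    -- The part of `X` on `R`, normalised; if it has mass zero, the empty team serves instead. The
    -- split below uses `P` and its negation, with the mass of `P` as `k`.
    have norm : ∀ (R : Assignment D A → Prop) [DecidablePred R],
        ∃ Y : Team D A, Y.IsDistributionOrEmpty ∧
        (∀ s, Y s ≠ 0 → X s ≠ 0 ∧ R s) ∧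
        ∀ s, (∑ s, if R s then X s else 0) * Y s = if R s then X s else 0 := by
      intro R _
      have h0 : ∀ s, 0 ≤ if R s then X s else 0 := fun s => by split_ifs <;> simp [hX.1]
      by_cases hk : (∑ s, if R s then X s else 0) = 0
      · refine ⟨fun _ => 0, Or.inr fun _ => rfl, by simp, fun s => ?_⟩
        rw [(Finset.sum_eq_zero_iff_of_nonneg fun s _ => h0 s).1 hk s (Finset.mem_univ s), mul_zero]
      · refine ⟨fun s => (if R s then X s else 0) / ∑ s, if R s then X s else 0,
          Or.inl ⟨fun s => div_nonneg (h0 s) (Finset.sum_nonneg fun s _ => h0 s), ?_⟩,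
          fun s hs => ?_, fun s => mul_div_cancel₀ _ hk⟩
        · rw [← Finset.sum_div, div_self hk]
        · by_cases hR : R s
          · exact ⟨fun h => hs (by simp [h]), hR⟩
          · exact absurd (by simp [hR]) hs
    obtain ⟨Y, hY, hYs, hYk⟩ := norm P
    obtain ⟨Z, hZ, hZs, hZk⟩ := norm fun s => ¬ P s
    have hsum : (∑ s, if P s then X s else 0) + (∑ s, if ¬ P s then X s else 0) = 1 := by
      rw [← Finset.sum_add_distrib, ← hX.2]
      exact Finset.sum_congr rfl fun s _ => by by_cases hs : P s <;> simp [hs]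
    have hk : 1 - (∑ s, if P s then X s else 0) = ∑ s, if ¬ P s then X s else 0 := by linarith
    have h0 : 0 ≤ ∑ s, if ¬ P s then X s else 0 :=
      Finset.sum_nonneg fun s _ => by split_ifs <;> simp [hX.1]
    refine ⟨∑ s, if P s then X s else 0, Y, Z,
      Finset.sum_nonneg fun s _ => by split_ifs <;> simp [hX.1], by linarith, hY, hZ, ?_,
      (hφ Y).2 fun s hs => (hYs s hs).2, (hψ Z).2 fun s hs => ?_⟩
    · funext s
      rw [Team.scaledUnion, hk, hYk, hZk]
      by_cases hs : P s <;> simp [hs]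
    · exact (h s (hZs s hs).1).resolve_left (hZs s hs).2

theorem Team.extend_eq_zero {X : Team D A} (hX : ∀ s, X s = 0) (x : ℕ)
    (F : Assignment D A → A → ℝ) (s : Assignment (insert x D) A) : X.extend x F s = 0 := by
  simp [Team.extend, hX]

/-- The empty team satisfies every formula. -/
theorem Formula.sat_of_eq_zero [Nonempty A] (φ : Formula L) {D : Finset ℕ} {X : Team D A}
    (hX : ∀ s, X s = 0) : φ.Sat X := by
  classical
  induction φ generalizing D with
  | rel R x => exact fun s hs => absurd (hX s) hs
  | nrel R x => exact fun s hs => absurd (hX s) hs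
  | eq x y => exact fun s hs => absurd (hX s) hs
  | neq x y => exact fun s hs => absurd (hX s) hs
  | atom α =>
    cases α with
    | indep x y z =>
      intro s
      simp [Team.weightAt, Team.weight, hX]
    | entropy x y =>
      simp [Formula.Sat, DepAtom.Holds, Team.entropy, Team.weight, hX]
  | and φ ψ h₁ h₂ => exact ⟨h₁ hX, h₂ hX⟩
  | or φ ψ h₁ h₂ =>
    refine ⟨0, X, X, le_rfl, zero_le_one, Or.inr hX, Or.inr hX, ?_, h₁ hX, h₂ hX⟩
    funext s
    simp [Team.scaledUnion]
  | ex x φ h => exact ⟨_, fun _ => uniform_isDistribution, h (Team.extend_eq_zero hX x _)⟩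
  | all x φ h => exact h (Team.extend_eq_zero hX x _)

end Flatness

/-! ### Defining conditional copies of variables -/

section CaseDistinction

variable {A : Type w} {D : Finset ℕ} {L : FirstOrder.Language.{u, v}}

open Classical in
/-- The value of `y` if `p` and `q` have the same value, and the value of `p` otherwise. -/
noncomputable def caseValue (p q y : ℕ) (f : ℕ → A) : A := if f p = f q then f y else f p

theorem caseValue_congr {p q y : ℕ} {f g : ℕ → A} (hp : f p = g p) (hq : f q = g q)
    (hy : f y = g y) : caseValue p q y f = caseValue p q y g := by
  rw [caseValue, caseValue, hp, hq, hy]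

open Classical in
/-- The valuation `f`, in which `y + S` gets the value `caseValue p q y f` for each `y` in `ys`. -/
noncomputable def caseValuation (p q S : ℕ) (ys : List ℕ) (f : ℕ → A) : ℕ → A :=
  fun w => if S ≤ w ∧ w - S ∈ ys then caseValue p q (w - S) f else f w

theorem caseValuation_of_lt {p q S w : ℕ} (ys : List ℕ) (f : ℕ → A) (h : w < S) :
    caseValuation p q S ys f w = f w := by
  simp [caseValuation, h.not_ge]

theorem caseValuation_add {p q S w : ℕ} {ys : List ℕ} (f : ℕ → A) (h : w ∈ ys) :
    caseValuation p q S ys f (w + S) = caseValue p q w f := by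
  simp [caseValuation, h]

/-- The copies live at or above `S` and the variables they read lie below it, so introducing one
copy does not disturb the others. Repetitions in the list are harmless. -/
theorem caseValuation_cons {p q S y : ℕ} {ys : List ℕ} (hp : p < S) (hq : q < S)
    (hys : ∀ w ∈ ys, w < S) (f : ℕ → A) :
    caseValuation p q S ys (Function.update f (y + S) (caseValue p q y f)) =
      caseValuation p q S (y :: ys) f := by
  have hlt : ∀ w < S, Function.update f (y + S) (caseValue p q y f) w = f w := fun w hw =>
    Function.update_of_ne (by omega) _ _
  funext w
  by_cases h : S ≤ w
  · obtain ⟨w, rfl⟩ := Nat.exists_eq_add_of_le' h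
    by_cases hw : w ∈ ys
    · rw [caseValuation_add _ hw, caseValuation_add _ (List.mem_cons_of_mem _ hw)]
      exact caseValue_congr (hlt _ hp) (hlt _ hq) (hlt _ (hys w hw))
    · by_cases hy : w = y
      · subst hy
        rw [caseValuation_add _ List.mem_cons_self]
        simp [caseValuation, hw]
      · simp [caseValuation, hw, hy]
  · rw [caseValuation_of_lt _ _ (not_le.1 h), caseValuation_of_lt _ _ (not_le.1 h),
      hlt _ (not_le.1 h)]

/-- The formula `∃ u (u = caseValue p q y ∧ ψ)`. -/
def Formula.letCase (p q y u : ℕ) (ψ : Formula L) : Formula L :=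
  .ex u (.and (.or (.and (.eq p q) (.eq u y)) (.and (.neq p q) (.eq u p))) ψ)

/-- The formula that introduces `y + S` for the value `caseValue p q y`, for each `y` in `ys`. -/
def Formula.letCases (p q S : ℕ) : List ℕ → Formula L → Formula L
  | [], ψ => ψ
  | y :: ys, ψ => .letCase p q y (y + S) (letCases p q S ys ψ)

theorem Formula.mem_free_letCases {p q S w : ℕ} {ys : List ℕ} {ψ : Formula L}
    (h : w ∈ (Formula.letCases p q S ys ψ).free) :
    w = p ∨ w = q ∨ w ∈ ys ∨ (w ∈ ψ.free ∧ ∀ y ∈ ys, w ≠ y + S) := by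
  induction ys with
  | nil => exact Or.inr (Or.inr (Or.inr ⟨h, by simp⟩))
  | cons y ys ih =>
    simp only [letCases, letCase, free, Finset.mem_erase, Finset.mem_union, Finset.mem_insert,
      Finset.mem_singleton] at h
    simp only [List.mem_cons, forall_eq_or_imp]
    tauto

theorem Formula.atomsIn_letCases {P : DepAtom → Prop} {p q S : ℕ} {ys : List ℕ} {ψ : Formula L}
    (h : ψ.AtomsIn P) : (Formula.letCases p q S ys ψ).AtomsIn P := by
  induction ys with
  | nil => exact h
  | cons y ys ih => exact ⟨⟨⟨trivial, trivial⟩, ⟨trivial, trivial⟩⟩, ih⟩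

variable [Fintype A] [Nonempty A] [L.Structure A]

theorem Formula.sat_eq_iff {x y : ℕ} (hx : x ∈ D) (hy : y ∈ D) (X : Team D A) :
    (Formula.eq x y : Formula L).Sat X ↔ ∀ s, X s ≠ 0 → s.total x = s.total y := by
  simp [Formula.Sat, Assignment.hasValue_iff, hx, hy, eq_comm]

theorem Formula.sat_neq_iff {x y : ℕ} (hx : x ∈ D) (hy : y ∈ D) (X : Team D A) :
    (Formula.neq x y : Formula L).Sat X ↔ ∀ s, X s ≠ 0 → s.total x ≠ s.total y := by
  simp [Formula.Sat, Assignment.hasValue_iff, hx, hy]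

/-- The guard is flat, so it fixes `u` pointwise on the support, and any witness `F` yields the same
team as the point mass. -/
theorem Formula.sat_letCase {p q y u : ℕ} (hp : p ∈ D) (hq : q ∈ D) (hy : y ∈ D) (hpu : p ≠ u)
    (hqu : q ≠ u) (hyu : y ≠ u) {ψ : Formula L} {X : Team D A} (hX : X.IsDistribution) :
    (Formula.letCase p q y u ψ).Sat X ↔
      ψ.Sat (X.extend u (pointMass fun t => caseValue p q y t.total)) := by
  have hp' := Finset.mem_insert_of_mem (b := u) hp
  have hq' := Finset.mem_insert_of_mem (b := u) hq
  have hy' := Finset.mem_insert_of_mem (b := u) hy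
  have hu' := Finset.mem_insert_self u D
  have hguard : ∀ {Y : Team (insert u D) A}, Y.IsDistribution →
      ((Formula.or (.and (.eq p q) (.eq u y)) (.and (.neq p q) (.eq u p)) : Formula L).Sat Y ↔
        ∀ s, Y s ≠ 0 → s.total u = caseValue p q y s.total) := by
    intro Y hY
    rw [Formula.sat_or_iff_of_flat
      (P := fun s => s.total p = s.total q ∧ s.total u = s.total y)
      (Q := fun s => s.total p ≠ s.total q ∧ s.total u = s.total p) _ _ hY]
    · refine forall₂_congr fun s _ => ?_
      by_cases h : s.total p = s.total q <;> simp [caseValue, h]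
    · intro Z
      simp only [Formula.Sat.eq_6, Formula.sat_eq_iff hp' hq', Formula.sat_eq_iff hu' hy']
      exact ⟨fun h s hs => ⟨h.1 s hs, h.2 s hs⟩, fun h => ⟨fun s hs => (h s hs).1,
        fun s hs => (h s hs).2⟩⟩
    · intro Z
      simp only [Formula.Sat.eq_6, Formula.sat_neq_iff hp' hq', Formula.sat_eq_iff hu' hp']
      exact ⟨fun h s hs => ⟨h.1 s hs, h.2 s hs⟩, fun h => ⟨fun s hs => (h s hs).1,
        fun s hs => (h s hs).2⟩⟩
  have hupd : ∀ (t : Assignment D A) a,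
      caseValue p q y (t.update u a).total = caseValue p q y t.total := by
    intro t a
    have : ∀ w ∈ D, w ≠ u → (t.update u a).total w = t.total w := fun w hw hwu => by
      rw [Assignment.total_update _ _ hw, Function.update_of_ne hwu]
    exact caseValue_congr (this p hp hpu) (this q hq hqu) (this y hy hyu)
  constructor
  · rintro ⟨F, hF, hg, hψ⟩
    rw [hguard (hX.extend hF)] at hg
    rwa [← Team.extend_eq_extend_pointMass hX.1 hF fun t a h => ?_]
    have := hg _ h
    rwa [hupd, Assignment.total_update_self] at this
  · intro h
    refine ⟨_, pointMass_isDistribution _, (hguard (hX.extend (pointMass_isDistribution _))).2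
      fun s hs => ?_, h⟩
    classical
    rw [Team.extend_apply] at hs
    obtain ⟨t, -, ht⟩ := Finset.exists_ne_zero_of_sum_ne_zero hs
    obtain ⟨a, -, ha⟩ := Finset.exists_ne_zero_of_sum_ne_zero ht
    rw [ite_ne_right_iff] at ha
    obtain ⟨rfl, ha⟩ := ha
    rw [hupd, Assignment.total_update_self]
    by_contra hne
    exact ha (by simp [pointMass, hne])

/-- The continuation `h` ranges over all domains `D'`, because each copy enlarges the domain; only
the law of the final team matters. -/
theorem Formula.sat_letCases {Ω : Type*} [Fintype Ω] {P : Ω → ℝ} {V : Ω → ℕ → A} {p q S : ℕ}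
    {ys : List ℕ} (hpS : p < S) (hqS : q < S) (hyS : ∀ y ∈ ys, y < S) (hp : p ∈ D) (hq : q ∈ D)
    (hy : ∀ y ∈ ys, y ∈ D) {ψ : Formula L} {X : Team D A} (hX : X.IsDistribution)
    (hV : X.IsLaw P V) {C : Prop}
    (h : ∀ (D' : Finset ℕ) (X' : Team D' A), D ⊆ D' → (∀ y ∈ ys, y + S ∈ D') →
      X'.IsDistribution → X'.IsLaw P (fun ω => caseValuation p q S ys (V ω)) → (ψ.Sat X' ↔ C)) :
    (Formula.letCases p q S ys ψ).Sat X ↔ C := by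
  induction ys generalizing D V with
  | nil =>
    refine h D X subset_rfl (by simp) hX ?_
    have : ∀ f : ℕ → A, caseValuation p q S [] f = f := fun f => by funext w; simp [caseValuation]
    simpa only [this] using hV
  | cons y ys ih =>
    simp only [List.mem_cons, forall_eq_or_imp] at hyS hy
    rw [letCases, sat_letCase hp hq hy.1 (by omega) (by omega) (by omega) hX]
    have hV' := hV.extend_pointMass (y + S)
      (g := fun t => caseValue p q y t.total) (g' := caseValue p q y) fun f =>
        caseValue_congr (Assignment.total_restrict hp) (Assignment.total_restrict hq)
          (Assignment.total_restrict hy.1)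
    refine ih hyS.2 (Finset.mem_insert_of_mem hp) (Finset.mem_insert_of_mem hq)
      (fun w hw => Finset.mem_insert_of_mem (hy.2 w hw))
      (hX.extend (pointMass_isDistribution _)) hV' fun D' X' hD hS hX' hVX => ?_
    simp only [caseValuation_cons hpS hqS hyS.2] at hVX
    refine h D' X' ((Finset.subset_insert _ _).trans hD) ?_ hX' hVX
    simp only [List.mem_cons, forall_eq_or_imp]
    exact ⟨hD (Finset.mem_insert_self _ _), hS⟩

end CaseDistinction

/-! ### Translating the independence atom -/

section Translation

variable {L : FirstOrder.Language.{u, v}}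

/-- The translation of the atom `y ⊥⊥_x z`, with fresh variables from `K` on: quantify `a`, `b`, `c`
uniformly, let `u`, `v` be copies of `y`, `z` that are erased unless `a = b`, let `v'` be a copy of
`z` that is erased unless `a = c`, and state `H(a b c x u v) = H(a b c x u v')`. -/
def Formula.ofIndep (K : ℕ) (x y z : List ℕ) : Formula L :=
  .all K <| .all (K + 1) <| .all (K + 2) <|
    .letCases K (K + 1) (K + 3) y <| .letCases K (K + 1) (2 * (K + 3)) z <|
    .letCases K (K + 2) (3 * (K + 3)) z <|
    .atom <| .entropy
      (K :: (K + 1) :: (K + 2) :: (x ++ y.map (· + (K + 3)) ++ z.map (· + 2 * (K + 3))))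
      (K :: (K + 1) :: (K + 2) :: (x ++ y.map (· + (K + 3)) ++ z.map (· + 3 * (K + 3))))

theorem Formula.atomsIn_ofIndep (K : ℕ) (x y z : List ℕ) :
    (Formula.ofIndep K x y z : Formula L).AtomsIn DepAtom.IsEntropy :=
  atomsIn_letCases (atomsIn_letCases (atomsIn_letCases trivial))

theorem Formula.free_ofIndep_subset (K : ℕ) (x y z : List ℕ) :
    (Formula.ofIndep K x y z : Formula L).free ⊆ (DepAtom.indep x y z).vars := by
  intro w hw
  simp only [ofIndep, free, Finset.mem_erase] at hw
  obtain ⟨h0, h1, h2, hw⟩ := hw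
  simp only [DepAtom.vars, List.mem_toFinset, List.mem_append]
  rcases mem_free_letCases hw with h | h | h | ⟨h, hy⟩
  · exact absurd h h0
  · exact absurd h h1
  · tauto
  rcases mem_free_letCases h with h | h | h | ⟨h, hz⟩
  · exact absurd h h0
  · exact absurd h h1
  · tauto
  rcases mem_free_letCases h with h | h | h | ⟨h, hz'⟩
  · exact absurd h h0
  · exact absurd h h2
  · tauto
  simp only [free, DepAtom.vars, List.mem_toFinset, List.mem_append, List.mem_cons,
    List.mem_map] at h
  rcases h with (h | h | h | (h | ⟨t, ht, rfl⟩) | ⟨t, ht, rfl⟩) |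
    (h | h | h | (h | ⟨t, ht, rfl⟩) | ⟨t, ht, rfl⟩)
  · exact absurd h h0
  · exact absurd h h1
  · exact absurd h h2
  · tauto
  · exact absurd rfl (hy t ht)
  · exact absurd rfl (hz t ht)
  · exact absurd h h0
  · exact absurd h h1
  · exact absurd h h2
  · tauto
  · exact absurd rfl (hy t ht)
  · exact absurd rfl (hz' t ht)

variable {A : Type w}

/-- The partition of the assignments by the values of `x`, together with those of `y` if `P` holds
and those of `z` if `Q` holds. -/
def agreement {Ω : Type*} (V : Ω → ℕ → A) (x y z : List ℕ) (P Q : Prop) (ω ω' : Ω) : Prop :=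
  (∀ w ∈ x, V ω w = V ω' w) ∧ (P → ∀ w ∈ y, V ω w = V ω' w) ∧ (Q → ∀ w ∈ z, V ω w = V ω' w)

theorem agreement_refl {Ω : Type*} (V : Ω → ℕ → A) (x y z : List ℕ) (P Q : Prop) (ω : Ω) :
    agreement V x y z P Q ω ω := by
  simp [agreement]

variable [Fintype A]

/-- Independence gives the entropy identity by taking logarithms; the converse is the equality case
of the nonnegativity of mutual information. -/
theorem holds_indep_iff {D : Finset ℕ} {Ω : Type*} [Fintype Ω] {X : Team D A} {p : Ω → ℝ}
    {V : Ω → ℕ → A} (hV : X.IsLaw p V) (hp : ∀ ω, 0 ≤ p ω) {x y z : List ℕ}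
    (hx : ∀ w ∈ x, w ∈ D) (hy : ∀ w ∈ y, w ∈ D) (hz : ∀ w ∈ z, w ∈ D) :
    (DepAtom.indep x y z).Holds X ↔
      relEntropy p (agreement V x y z True False) + relEntropy p (agreement V x y z False True) =
        relEntropy p (agreement V x y z True True) +
          relEntropy p (agreement V x y z False False) := by
  classical
  have hxy : ∀ w ∈ x ++ y, w ∈ D := by simpa [or_imp, forall_and] using ⟨hx, hy⟩
  have hxz : ∀ w ∈ x ++ z, w ∈ D := by simpa [or_imp, forall_and] using ⟨hx, hz⟩
  have hxyz : ∀ w ∈ x ++ y ++ z, w ∈ D := by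
    simpa [or_imp, forall_and] using ⟨hx, hy, hz⟩
  constructor
  · intro h
    refine relEntropy_add_eq hp (agreement_refl V x y z _ _) (agreement_refl V x y z _ _)
      (agreement_refl V x y z _ _) (agreement_refl V x y z _ _) fun ω _ => ?_
    have := h (V ω)
    rw [hV.weightAt_eq hxy, hV.weightAt_eq hxz, hV.weightAt_eq hxyz, hV.weightAt_eq hx] at this
    simpa [classWeight, agreement, or_imp, forall_and, and_assoc] using this
  · intro h s
    rw [hV.weightAt_eq hxy, hV.weightAt_eq hxz, hV.weightAt_eq hxyz, hV.weightAt_eq hx]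
    -- Tuples become functions on their finite set of variables, so that the values range over
    -- finite types.
    let res (l : List ℕ) (f : ℕ → A) : {w // w ∈ l.toFinset} → A := fun w => f w.1
    have hres : ∀ l f f', res l f = res l f' ↔ ∀ w ∈ l, f w = f' w := by
      intro l f f'
      simp [res, funext_iff]
    unfold agreement at h
    have := factorizes_of_relEntropy_add_eq hp (fun ω => res x (V ω)) (fun ω => res y (V ω))
      (fun ω => res z (V ω)) (by simpa [hres] using h)
      (res x s) (res y s) (res z s)
    simp only [hres] at this
    simpa [or_imp, forall_and, and_assoc] using this

/-- The chain rule applied to the three uniform coordinates, peeled off from the last to the first.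
The constant is shared by all partitions. -/
theorem relEntropy_prod_three {α : Type*} [Fintype α] {Ω : Type*} [Fintype Ω] {p : Ω → ℝ}
    (hp : ∀ ω, 0 ≤ p ω) {c : ℝ} (hc : 0 < c) :
    ∃ C : ℝ, ∀ (r : ((Ω × α) × α) × α → ((Ω × α) × α) × α → Prop)
      (q : α → α → α → Ω → Ω → Prop), (∀ a₁ a₂ a₃ ω, q a₁ a₂ a₃ ω ω) →
      (∀ ω a₁ a₂ a₃ ω' a₁' a₂' a₃', r (((ω, a₁), a₂), a₃) (((ω', a₁'), a₂'), a₃') ↔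
        a₁ = a₁' ∧ a₂ = a₂' ∧ a₃ = a₃' ∧ q a₁ a₂ a₃ ω ω') →
      relEntropy (fun t : ((Ω × α) × α) × α => p t.1.1.1 * c * c * c) r =
        c ^ 3 * (∑ a₃, ∑ a₂, ∑ a₁, relEntropy p (q a₁ a₂ a₃)) + C := by
  have hp1 : ∀ z : Ω × α, 0 ≤ p z.1 * c := fun z => mul_nonneg (hp _) hc.le
  have hp2 : ∀ z : (Ω × α) × α, 0 ≤ p z.1.1 * c * c := fun z => mul_nonneg (hp1 _) hc.le
  obtain ⟨C₁, h₁⟩ := exists_relEntropy_prod_eq (α := α) hp hc.ne'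
  obtain ⟨C₂, h₂⟩ := exists_relEntropy_prod_eq (α := α) hp1 hc.ne'
  obtain ⟨C₃, h₃⟩ := exists_relEntropy_prod_eq (α := α) hp2 hc.ne'
  refine ⟨c ^ 2 * Fintype.card α * Fintype.card α * C₁ + c * Fintype.card α * C₂ + C₃,
    fun r q hq hr => ?_⟩
  rw [h₃ r (fun a₃ t t' => t.2 = t'.2 ∧ t.1.2 = t'.1.2 ∧ q t.1.2 t.2 a₃ t.1.1 t'.1.1)
    (fun a₃ t => ⟨rfl, rfl, hq _ _ _ _⟩) (fun ω a ω' a' => by rw [hr]; tauto)]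
  have e₂ := fun a₃ => h₂ (fun t t' => t.2 = t'.2 ∧ t.1.2 = t'.1.2 ∧ q t.1.2 t.2 a₃ t.1.1 t'.1.1)
    (fun a₂ t t' => t.2 = t'.2 ∧ q t.2 a₂ a₃ t.1 t'.1)
    (fun a₂ t => ⟨rfl, hq _ _ _ _⟩) (fun ω a ω' a' => Iff.rfl)
  have e₁ := fun a₃ a₂ => h₁ (fun t t' => t.2 = t'.2 ∧ q t.2 a₂ a₃ t.1 t'.1)
    (fun a₁ => q a₁ a₂ a₃) (fun a₁ t => hq _ _ _ _) (fun ω a ω' a' => Iff.rfl)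
  simp only [e₂, e₁, Finset.sum_add_distrib, ← Finset.mul_sum, Finset.sum_const, Finset.card_univ,
    nsmul_eq_mul]
  ring

/-- Among the triples `(a, b, c)`, the cases `a = b ≠ c` and `a = c ≠ b` are equally frequent. -/
theorem sum_cases_sub (f : Prop → Prop → ℝ) :
    (∑ _ : A, ∑ b : A, ∑ a : A, f (a = b) (a = b)) - ∑ c : A, ∑ b : A, ∑ a : A, f (a = b) (a = c) =
      ((Fintype.card A : ℝ) ^ 2 - Fintype.card A) *
        (f True True + f False False - (f True False + f False True)) := by
  classical
  have key : ∀ P Q : Prop, f P P - f P Q =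
      ((if P then 1 else 0) - (if P then if Q then 1 else 0 else 0)) *
        (f True True - f True False) +
      ((if Q then 1 else 0) - (if P then if Q then 1 else 0 else 0)) *
        (f False False - f False True) := by
    intro P Q
    by_cases hP : P <;> by_cases hQ : Q <;> simp [hP, hQ]
  -- Summed over all triples, a = b and a = c each count n², and a = b = c counts n; both
  -- coefficients become n² - n.
  have key' := fun a b c : A => key (a = b) (a = c)
  simp only [← Finset.sum_sub_distrib, key']
  simp only [Finset.sum_add_distrib, ← Finset.sum_mul, Finset.sum_sub_distrib]
  simp
  ring

variable [Nonempty A] [L.Structure A]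

theorem Formula.sat_ofIndep_iff {D : Finset ℕ} {X : Team D A} (hX : X.IsDistribution) {K : ℕ}
    {x y z : List ℕ} (hx : ∀ w ∈ x, w ∈ D) (hy : ∀ w ∈ y, w ∈ D) (hz : ∀ w ∈ z, w ∈ D)
    (hxK : ∀ w ∈ x, w < K) (hyK : ∀ w ∈ y, w < K) (hzK : ∀ w ∈ z, w < K) :
    (Formula.ofIndep K x y z : Formula L).Sat X ↔ (DepAtom.indep x y z).Holds X := by
  have hV := X.isLaw_total
  rw [holds_indep_iff hV hX.1 hx hy hz]
  set V : Assignment D A → ℕ → A := fun s => s.total with hVdef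
  set c : ℝ := 1 / (Fintype.card A : ℝ) with hc
  have hcard : (0 : ℝ) < Fintype.card A := by exact_mod_cast Fintype.card_pos
  have hc0 : 0 < c := by positivity
  have hV3 := ((hV.extendUniform K).extendUniform (K + 1)).extendUniform (K + 2)
  have hX3 := ((hX.extendUniform K).extendUniform (K + 1)).extendUniform (K + 2)
  refine Formula.sat_letCases (by omega) (by omega) (fun w hw => by have := hyK w hw; omega)
    (by simp) (by simp) (fun w hw => by simp [hy w hw]) hX3 hV3 fun D₁ X₁ hD₁ hy₁ hX₁ hV₁ => ?_
  refine Formula.sat_letCases (by omega) (by omega) (fun w hw => by have := hzK w hw; omega)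
    (hD₁ (by simp)) (hD₁ (by simp)) (fun w hw => hD₁ (by simp [hz w hw])) hX₁ hV₁
    fun D₂ X₂ hD₂ hy₂ hX₂ hV₂ => ?_
  refine Formula.sat_letCases (by omega) (by omega) (fun w hw => by have := hzK w hw; omega)
    (hD₂ (hD₁ (by simp))) (hD₂ (hD₁ (by simp))) (fun w hw => hD₂ (hD₁ (by simp [hz w hw]))) hX₂ hV₂
    fun D₃ X₃ hD₃ hy₃ hX₃ hV₃ => ?_
  have hDD : ∀ w ∈ insert (K + 2) (insert (K + 1) (insert K D)), w ∈ D₃ :=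
    fun w hw => hD₃ (hD₂ (hD₁ hw))
  have hbase : ∀ w ∈ K :: (K + 1) :: (K + 2) :: (x ++ y.map (· + (K + 3))), w ∈ D₃ := by
    simp only [List.mem_cons, List.mem_append, List.mem_map]
    rintro w (rfl | rfl | rfl | h | ⟨t, ht, rfl⟩)
    · exact hDD _ (by simp)
    · exact hDD _ (by simp)
    · exact hDD _ (by simp)
    · exact hDD _ (by simp [hx w h])
    · exact hD₃ (hD₂ (hy₁ t ht))
  rw [Formula.Sat, DepAtom.Holds, hV₃.entropy_eq, hV₃.entropy_eq]
  rotate_left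
  · intro w hw
    rw [← List.cons_append, ← List.cons_append, ← List.cons_append, List.mem_append] at hw
    rcases hw with hw | hw
    · exact hbase w hw
    · obtain ⟨t, ht, rfl⟩ := List.mem_map.1 hw
      exact hy₃ t ht
  · intro w hw
    rw [← List.cons_append, ← List.cons_append, ← List.cons_append, List.mem_append] at hw
    rcases hw with hw | hw
    · exact hbase w hw
    · obtain ⟨t, ht, rfl⟩ := List.mem_map.1 hw
      exact hD₃ (hy₂ t ht)
  obtain ⟨C, hC⟩ := relEntropy_prod_three (α := A) hX.1 hc0
  -- The valuation, on the sample space of the team and three uniform values, that carries all the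
  -- copies.
  set W : ((Assignment D A × A) × A) × A → ℕ → A := fun ω =>
    caseValuation K (K + 2) (3 * (K + 3)) z (caseValuation K (K + 1) (2 * (K + 3)) z
      (caseValuation K (K + 1) (K + 3) y (Function.update (Function.update
        (Function.update (V ω.1.1.1) K ω.1.1.2) (K + 1) ω.1.2) (K + 2) ω.2))) with hW
  have W1 : ∀ t w, w < K + 3 → W t w = Function.update (Function.update
        (Function.update (V t.1.1.1) K t.1.1.2) (K + 1) t.1.2) (K + 2) t.2 w := by
    intro t w hw
    rw [hW]
    dsimp only
    rw [caseValuation_of_lt _ _ (by omega), caseValuation_of_lt _ _ (by omega),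
      caseValuation_of_lt _ _ (by omega)]
  have Wa : ∀ t, W t K = t.1.1.2 := fun t => by rw [W1 t K (by omega)]; simp [Function.update]
  have Wb : ∀ t, W t (K + 1) = t.1.2 := fun t => by
    rw [W1 t _ (by omega)]; simp [Function.update]
  have Wc : ∀ t, W t (K + 2) = t.2 := fun t => by rw [W1 t _ (by omega)]; simp [Function.update]
  have Wold : ∀ t w, w < K → W t w = V t.1.1.1 w := fun t w hw => by
    rw [W1 t w (by omega), Function.update_of_ne (by omega), Function.update_of_ne (by omega),
      Function.update_of_ne (by omega)]
  have hcase : ∀ t p q w, p < K + 3 → q < K + 3 → w < K + 3 → caseValue p q w (Function.update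
      (Function.update (Function.update (V t.1.1.1) K t.1.1.2) (K + 1) t.1.2) (K + 2) t.2) =
        caseValue p q w (W t) := by
    intro t p q w hp hq hw
    exact (caseValue_congr (W1 t p hp) (W1 t q hq) (W1 t w hw)).symm
  have Wu : ∀ t, ∀ w ∈ y, W t (w + (K + 3)) = caseValue K (K + 1) w (W t) := fun t w hw => by
    have := hyK w hw
    rw [← hcase t _ _ _ (by omega) (by omega) (by omega), hW]
    dsimp only
    rw [caseValuation_of_lt _ _ (by omega), caseValuation_of_lt _ _ (by omega),
      caseValuation_add _ hw]
  have Wv : ∀ t, ∀ w ∈ z, W t (w + 2 * (K + 3)) = caseValue K (K + 1) w (W t) := fun t w hw => by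
    have := hzK w hw
    rw [← hcase t _ _ _ (by omega) (by omega) (by omega), hW]
    dsimp only
    rw [caseValuation_of_lt _ _ (by omega), caseValuation_add _ hw]
    refine caseValue_congr ?_ ?_ ?_ <;> rw [caseValuation_of_lt _ _ (by omega)]
  have Wv' : ∀ t, ∀ w ∈ z, W t (w + 3 * (K + 3)) = caseValue K (K + 2) w (W t) := fun t w hw => by
    have := hzK w hw
    rw [← hcase t _ _ _ (by omega) (by omega) (by omega), hW]
    dsimp only
    rw [caseValuation_add _ hw]
    refine caseValue_congr ?_ ?_ ?_ <;>
      rw [caseValuation_of_lt _ _ (by omega), caseValuation_of_lt _ _ (by omega)]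
  -- Once a and the variable `q` agree in both samples, both make the same case choice; erased
  -- copies equal the shared a and impose no condition.
  have hagree : ∀ (l : List ℕ), (∀ w ∈ l, w < K) → ∀ (q : ℕ)
      (t t' : ((Assignment D A × A) × A) × A), W t K = W t' K → W t q = W t' q →
      ((∀ w ∈ l, caseValue K q w (W t) = caseValue K q w (W t')) ↔
        (W t K = W t q → ∀ w ∈ l, V t.1.1.1 w = V t'.1.1.1 w)) := by
    intro l hl q t t' h₁ h₂
    by_cases h : W t K = W t q
    · simp only [h, true_imp_iff]
      refine forall₂_congr fun w hw => ?_
      rw [caseValue, caseValue, if_pos h, if_pos (h₁ ▸ h₂ ▸ h), Wold _ _ (hl w hw),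
        Wold _ _ (hl w hw)]
    · simp only [h, false_imp_iff, iff_true]
      intro w _
      rw [caseValue, caseValue, if_neg h, if_neg (h₁ ▸ h₂ ▸ h), h₁]
  have hWx : ∀ t t', (∀ w ∈ x, W t w = W t' w) ↔ ∀ w ∈ x, V t.1.1.1 w = V t'.1.1.1 w := fun t t' =>
    forall₂_congr fun w hw => by rw [Wold _ _ (hxK w hw), Wold _ _ (hxK w hw)]
  have hrel : ∀ (S q : ℕ), (∀ t, ∀ w ∈ z, W t (w + S) = caseValue K q w (W t)) →
      (q = K + 1 ∨ q = K + 2) → ∀ t t',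
      ((∀ w ∈ K :: (K + 1) :: (K + 2) :: (x ++ y.map (· + (K + 3)) ++ z.map (· + S)),
        W t w = W t' w) ↔ t.1.1.2 = t'.1.1.2 ∧ t.1.2 = t'.1.2 ∧ t.2 = t'.2 ∧
          agreement V x y z (t.1.1.2 = t.1.2) (t.1.1.2 = W t q) t.1.1.1 t'.1.1.1) := by
    intro S q hS hq t t'
    simp only [List.forall_mem_cons, List.forall_mem_append, List.forall_mem_map, Wa, Wb, Wc,
      and_assoc, hWx]
    refine and_congr_right fun ha => and_congr_right fun hb => and_congr_right fun hc => ?_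
    have hK : W t K = W t' K := by rw [Wa, Wa, ha]
    have hK1 : W t (K + 1) = W t' (K + 1) := by rw [Wb, Wb, hb]
    have hq' : W t q = W t' q := by
      rcases hq with rfl | rfl
      · exact hK1
      · rw [Wc, Wc, hc]
    have h₁ := hagree y hyK (K + 1) t t' hK hK1
    have h₂ := hagree z hzK q t t' hK hq'
    rw [Wa, Wb] at h₁
    rw [Wa] at h₂
    rw [agreement, ← h₁, ← h₂]
    refine and_congr_right fun _ => and_congr ?_ ?_
    · exact forall₂_congr fun w hw => by rw [Wu _ _ hw, Wu _ _ hw]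
    · exact forall₂_congr fun w hw => by rw [hS _ _ hw, hS _ _ hw]
  have hL := hC (fun ω ω' => ∀ w ∈ K :: (K + 1) :: (K + 2) ::
      (x ++ y.map (· + (K + 3)) ++ z.map (· + 2 * (K + 3))), W ω w = W ω' w)
    (fun a b _ => agreement V x y z (a = b) (a = b)) (fun _ _ _ _ => agreement_refl _ _ _ _ _ _ _)
    (fun ω a₁ a₂ a₃ ω' a₁' a₂' a₃' => by
      rw [hrel _ _ Wv (Or.inl rfl), Wb])
  have hR := hC (fun ω ω' => ∀ w ∈ K :: (K + 1) :: (K + 2) ::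
      (x ++ y.map (· + (K + 3)) ++ z.map (· + 3 * (K + 3))), W ω w = W ω' w)
    (fun a b c => agreement V x y z (a = b) (a = c)) (fun _ _ _ _ => agreement_refl _ _ _ _ _ _ _)
    (fun ω a₁ a₂ a₃ ω' a₁' a₂' a₃' => by
      rw [hrel _ _ Wv' (Or.inr rfl), Wc])
  rw [hL, hR, add_left_inj, mul_right_inj' (by positivity), ← sub_eq_zero,
    sum_cases_sub fun P Q => relEntropy X (agreement V x y z P Q), mul_eq_zero, sub_eq_zero,
    sub_eq_zero, eq_comm (a := relEntropy _ _ + relEntropy _ _), or_iff_right_iff_imp]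
  -- Here n² = n, so the universe has one element, all partitions are trivial and the identity
  -- holds.
  intro h1
  have h2 : Fintype.card A = 1 := by
    have : (Fintype.card A : ℝ) * (Fintype.card A - 1) = 0 := by linarith
    have := (mul_eq_zero.1 this).resolve_left hcard.ne'
    exact_mod_cast sub_eq_zero.1 this
  have := (Fintype.card_le_one_iff_subsingleton (α := A)).1 h2.le
  have h3 : ∀ P Q, agreement V x y z P Q = fun _ _ => True := fun P Q => by
    funext s s'
    simp [agreement, Subsingleton.elim (V s) (V s')]
  simp only [h3]

end Translation

/-- The translation of probabilistic independence logic into entropy logic. -/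
def Formula.toEntropy {L : FirstOrder.Language.{u, v}} : Formula L → Formula L
  -- Freshness is needed only relative to the atom: variables of the domain from this bound on may
  -- be overwritten.
  | .atom (.indep x y z) => .ofIndep ((DepAtom.indep x y z).vars.sup id + 1) x y z
  | .and φ ψ => .and φ.toEntropy ψ.toEntropy
  | .or φ ψ => .or φ.toEntropy ψ.toEntropy
  | .ex x φ => .ex x φ.toEntropy
  | .all x φ => .all x φ.toEntropy
  | φ => φ

theorem Formula.atomsIn_toEntropy {L : FirstOrder.Language.{u, v}} (φ : Formula L) :
    φ.toEntropy.AtomsIn DepAtom.IsEntropy := by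
  induction φ with
  | atom α =>
    cases α with
    | indep x y z => exact atomsIn_ofIndep _ _ _ _
    | entropy x y => trivial
  | and φ ψ h₁ h₂ => exact ⟨h₁, h₂⟩
  | or φ ψ h₁ h₂ => exact ⟨h₁, h₂⟩
  | ex x φ h => exact h
  | all x φ h => exact h
  | _ => trivial

theorem Formula.free_toEntropy_subset {L : FirstOrder.Language.{u, v}} (φ : Formula L) :
    φ.toEntropy.free ⊆ φ.free := by
  induction φ with
  | atom α =>
    cases α with
    | indep x y z => exact free_ofIndep_subset _ _ _ _
    | entropy x y => exact subset_rfl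
  | and φ ψ h₁ h₂ => exact Finset.union_subset_union h₁ h₂
  | or φ ψ h₁ h₂ => exact Finset.union_subset_union h₁ h₂
  | ex x φ h => exact Finset.erase_subset_erase _ h
  | all x φ h => exact Finset.erase_subset_erase _ h
  | _ => exact subset_rfl

/-- The empty team is included because a disjunction can pass it to a disjunct; it satisfies every
formula, hence both sides. -/
theorem Formula.sat_toEntropy_iff {L : FirstOrder.Language.{u, v}} {A : Type w} [Fintype A]
    [Nonempty A] [L.Structure A] (φ : Formula L) {D : Finset ℕ} (hD : φ.free ⊆ D) {X : Team D A}
    (hX : X.IsDistributionOrEmpty) : φ.toEntropy.Sat X ↔ φ.Sat X := by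
  induction φ generalizing D with
  | atom α =>
    rcases hX with hX | hX
    · cases α with
      | indep x y z =>
        have hlt : ∀ w ∈ (DepAtom.indep x y z).vars,
            w < (DepAtom.indep x y z).vars.sup id + 1 := fun w hw =>
          Nat.lt_succ_of_le (Finset.le_sup (f := id) hw)
        exact sat_ofIndep_iff hX
          (fun w hw => hD (by simp [free, DepAtom.vars, hw]))
          (fun w hw => hD (by simp [free, DepAtom.vars, hw]))
          (fun w hw => hD (by simp [free, DepAtom.vars, hw]))
          (fun w hw => hlt w (by simp [DepAtom.vars, hw]))
          (fun w hw => hlt w (by simp [DepAtom.vars, hw]))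
          (fun w hw => hlt w (by simp [DepAtom.vars, hw]))
      | entropy x y => exact Iff.rfl
    · exact iff_of_true (sat_of_eq_zero _ hX) (sat_of_eq_zero _ hX)
  | and φ ψ h₁ h₂ =>
    have hD := Finset.union_subset_iff.1 hD
    exact and_congr (h₁ hD.1 hX) (h₂ hD.2 hX)
  | or φ ψ h₁ h₂ =>
    have hD := Finset.union_subset_iff.1 hD
    constructor
    · rintro ⟨k, Y, Z, h0, h1, hY, hZ, e, hφ, hψ⟩
      exact ⟨k, Y, Z, h0, h1, hY, hZ, e, (h₁ hD.1 hY).1 hφ, (h₂ hD.2 hZ).1 hψ⟩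
    · rintro ⟨k, Y, Z, h0, h1, hY, hZ, e, hφ, hψ⟩
      exact ⟨k, Y, Z, h0, h1, hY, hZ, e, (h₁ hD.1 hY).2 hφ, (h₂ hD.2 hZ).2 hψ⟩
  | ex x φ h =>
    have hD := Finset.subset_insert_iff.2 hD
    refine exists_congr fun F => and_congr_right fun hF => h hD ?_
    exact hX.imp (fun hX => hX.extend hF) fun hX => Team.extend_eq_zero hX x F
  | all x φ h =>
    have hD := Finset.subset_insert_iff.2 hD
    exact h hD (hX.imp (fun hX => hX.extendUniform x) fun hX => Team.extend_eq_zero hX x _)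
  | _ => exact Iff.rfl

end ProbTeam

theorem mainTheorem4 (L : FirstOrder.Language.{u, v}) [L.IsRelational] :
    ProbTeam.Subsumed.{u, v, w} (ProbTeam.FOIndep L) (ProbTeam.FOEntropy L) := by
  intro φ _
  refine ⟨φ.toEntropy, φ.atomsIn_toEntropy, φ.free_toEntropy_subset, ?_⟩
  intro A _ _ _ D hφ _ X hX
  exact (φ.sat_toEntropy_iff hφ (Or.inl hX)).symm
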